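/- Let $k$ be $\mathbb F_2$ or $\mathbb F_3$, and let $G$ be a finite graph (loops and parallel edges allowed) with a fixed reference direction on every edge. The cycle space of $G$ over $k$ is the space of all vectors in $k^{E(G)}$ for which, at every vertex, the entering entries and the leaving entries have the same sum. A cycle of $G$ with a direction of traversal is identified with its vector in $k^{E(G)}$, which has entries $\pm1$ on its edges (according to the direction in which they are traversed) and $0$ elsewhere. Let $S$ be a subspace of the cycle space that is generated by a set of cycles of $G$. Let $\iota$ be an embedding of $G$ in a surface $\Sigma$ (a connected compact $2$-manifold without boundary). The faces of $\iota$ are the connected components of $\Sigma\setminus G$; they need not be discs. Fix a direction for the boundary of every face: the boundary walks of the faces are directed by an orientation of the part of the faces that lies in some open neighbourhood of $G$ (the neighbourhood may be small, so that distinct boundary walks are directed independently, or all of $\Sigma$, in which case every face is oriented). The boundary $\partial f\in k^{E(G)}$ of a face $f$ is the vector whose entry at an edge $e$ is the sum, over the sides of $e$ that lie in $f$, of $+1$ or $-1$ according to the direction in which the boundary of $f$ traverses $e$ along that side; for $k=\mathbb F_2$ it does not depend on the directions. For a set $A$ of faces write $\partial A=\sum_{f\in A}\partial f$. * $\iota$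 is $k$-admissible if the sum of $\partial f$ over all faces $f$ is zero. * $\iota$ is $S$-facial if for every cycle $o$ of $G$ in $S$ there is a set $A$ of faces with $\partial A=o$ or $\partial A=-o$. * A hole is a face $f$ with $\partial f\notin S$. An area is a set $A$ of faces with $\partial A\in S$; it fences in the set of all holes it contains. An area is minimal if it contains a hole and no area fences in a proper nonempty subset of the set of holes that it fences in. * $S$ is fencing in for $\iota$ if the sets of holes fenced in by any two minimal areas are identical or disjoint. * Two holes are related if they are contained in a common minimal area. * The $S$-local matroid of $G$ is the matroid on $E(G)$ whose circuits are the minimal nonempty supports of elements of $S$. * The dual graph $H$ of $\iota$ has the faces as vertices and $E(G)$ as edge set, and the edge $e$ joins the faces on the two sides of $e$. Assume that $\iota$ is $S$-facial and $k$-admissible, and that $S$ is fencing in for $\iota$. Then being related is an equivalence relation on the set of holes, the $S$-local matroid of $G$ is well defined, and the quotient of $H$ obtained by identifying related holes has cycle matroid equal to the dual of the $S$-local matroid of $G$. -/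

import Mathlib

namespace SurfaceDuality

/-! ### Multigraphs and cycles -/

/-- A multigraph with vertex type `V` and edge type `E`; loops and parallel edges are allowed.
Every edge comes with a reference direction from `src` to `tgt`, which fixes the signs in the
cycle space over a field of characteristic different from two. -/
structure Multigraph (V E : Type*) where
  src : E → V
  tgt : E → V

namespace Multigraph

variable {V E : Type*}

/-- The cycle space of `G` over `R`: the vectors indexed by the edges for which, at every vertex,
the sum of the entering entries equals the sum of the leaving entries. -/
def cycleSpace [Fintype E] (G : Multigraph V E) (R : Type*) [CommRing R] :
    Submodule R (E → R) := by
  classical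
  exact
  { carrier := {x | ∀ v : V,
      (∑ e, if G.tgt e = v then x e else 0) = ∑ e, if G.src e = v then x e else 0}
    zero_mem' := by intro v; simp
    add_mem' := by
      intro x y hx hy v
      have h (f : E → V) : (∑ e, if f e = v then (x + y) e else 0) =
          (∑ e, if f e = v then x e else 0) + ∑ e, if f e = v then y e else 0 := by
        rw [← Finset.sum_add_distrib]
        exact Finset.sum_congr rfl fun e _ => by split_ifs <;> simp
      rw [h, h, hx v, hy v]
    smul_mem' := by
      intro c x hx v
      have h (f : E → V) : (∑ e, if f e = v then (c • x) e else 0) =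
          c * ∑ e, if f e = v then x e else 0 := by
        rw [Finset.mul_sum]
        exact Finset.sum_congr rfl fun e _ => by split_ifs <;> simp
      rw [h, h, hx v] }

/-- A cycle of `G` with a direction of traversal. It visits the distinct vertices
`vertex 0, …, vertex n` and the distinct edges `edge 0, …, edge n`, where `edge i` joins
`vertex i` to `vertex (i + 1)` (addition modulo `n + 1`) and `sign i` tells whether `edge i` is
traversed along its reference direction. A loop is a cycle (`n = 0`), and so is a pair of parallel
edges (`n = 1`). -/
structure DirectedCycle (G : Multigraph V E) where
  n : ℕ
  vertex : Fin (n + 1) → V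
  edge : Fin (n + 1) → E
  sign : Fin (n + 1) → ℤˣ
  vertex_injective : Function.Injective vertex
  edge_injective : Function.Injective edge
  joins : ∀ i,
    (sign i = 1 ∧ G.src (edge i) = vertex i ∧ G.tgt (edge i) = vertex (i + 1)) ∨
    (sign i = -1 ∧ G.src (edge i) = vertex (i + 1) ∧ G.tgt (edge i) = vertex i)

/-- The edge set of a cycle. -/
def DirectedCycle.edgeSet {G : Multigraph V E} (C : G.DirectedCycle) : Set E :=
  Set.range C.edge

open Classical in
/-- The vector of a cycle over `R`: its entries are `1` or `-1` at the edges of the cycle, according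
to the direction in which they are traversed, and `0` elsewhere. -/
noncomputable def DirectedCycle.vec {G : Multigraph V E} (C : G.DirectedCycle)
    (R : Type*) [CommRing R] : E → R :=
  ∑ i, Pi.single (C.edge i) (((C.sign i : ℤ) : R))

/-- The quotient of `G` obtained by identifying `r`-related vertices; the edges stay the same. -/
def identify (G : Multigraph V E) (r : V → V → Prop) : Multigraph (Quot r) E where
  src e := Quot.mk r (G.src e)
  tgt e := Quot.mk r (G.tgt e)

/-- `M` is the cycle matroid of `G`: its ground set is the set of all edges, and its circuits are
the edge sets of the cycles of `G`. -/
def IsCycleMatroid (G : Multigraph V E) (M : Matroid E) : Prop :=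
  M.E = Set.univ ∧ ∀ C : Set E, M.IsCircuit C ↔ ∃ o : G.DirectedCycle, o.edgeSet = C

/-- A subspace has a cyclic generating set if it is generated by (the vectors of) a set of cycles
of `G`. -/
def HasCyclicGeneratingSet (G : Multigraph V E) {R : Type*} [CommRing R]
    (S : Submodule R (E → R)) : Prop :=
  ∃ T : Set G.DirectedCycle, Submodule.span R ((fun o => o.vec R) '' T) = S

end Multigraph

/-- `M` is the `S`-local matroid: its ground set is the set of all edges, and its circuits are the
minimal nonempty supports of elements of `S`. -/
def IsLocalMatroid {E R : Type*} [CommRing R] (S : Submodule R (E → R)) (M : Matroid E) : Prop :=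
  M.E = Set.univ ∧
    ∀ C : Set E, M.IsCircuit C ↔
      Minimal (fun D : Set E => D.Nonempty ∧ ∃ x ∈ S, Function.support x = D) C

/-! ### Embeddings in surfaces -/

/-- An embedding of a multigraph in a topological space `X`: the vertices are mapped to distinct
points and the edges to arcs between their endvertices (closed curves for loops) that are simple and
meet each other and the vertices only in common endpoints. No condition is put on the faces; in
particular they need not be discs. -/
structure GraphEmbedding {V E : Type*} (G : Multigraph V E) (X : Type*) [TopologicalSpace X] where
  point : V → X
  arc : E → C(unitInterval, X)
  point_injective : Function.Injective point
  arc_zero : ∀ e, arc e 0 = point (G.src e)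
  arc_one : ∀ e, arc e 1 = point (G.tgt e)
  arc_injOn : ∀ e, Set.InjOn (arc e) (Set.Ioo 0 1)
  arc_ne_arc : ∀ e e', e ≠ e' → ∀ s ∈ Set.Ioo (0 : unitInterval) 1,
    ∀ t ∈ Set.Ioo (0 : unitInterval) 1, arc e s ≠ arc e' t
  arc_ne_point : ∀ e, ∀ s ∈ Set.Ioo (0 : unitInterval) 1, ∀ v, arc e s ≠ point v

namespace GraphEmbedding

variable {V E : Type*} {G : Multigraph V E} {X : Type*} [TopologicalSpace X]

/-- The subset of `X` covered by the embedded graph. -/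
def carrier (ι : GraphEmbedding G X) : Set X :=
  Set.range ι.point ∪ ⋃ e, Set.range (ι.arc e)

/-- The faces of an embedding are the connected components of the complement of the graph. -/
def Face (ι : GraphEmbedding G X) : Type _ :=
  ConnectedComponents (ι.carrierᶜ : Set X)

/-- The face that contains a point outside the graph. -/
def faceOf (ι : GraphEmbedding G X) (x : X) (hx : x ∉ ι.carrier) : ι.Face :=
  ConnectedComponents.mk (⟨x, hx⟩ : (ι.carrierᶜ : Set X))

/-- A collar of an embedding is a choice of a thin open strip along the interior of every edge `e`.
The strip is parametrised by the complex plane: the real axis runs along the interior of `e` in the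
reference direction (`unitInterval.sigmoid` is an increasing bijection from the reals to the open
unit interval), and the rest of the strip avoids the graph. Every edge of a finite graph embedded in
a surface has such a strip, by the theorem of Schoenflies. The images of the open upper and lower
half planes are the two sides of the edge (left and right, as seen in the strip). -/
structure Collar (ι : GraphEmbedding G X) where
  strip : E → ℂ → X
  isOpenEmbedding : ∀ e, Topology.IsOpenEmbedding (strip e)
  strip_real : ∀ (e : E) (x : ℝ), strip e (x : ℂ) = ι.arc e (unitInterval.sigmoid x)
  strip_mem_carrier : ∀ (e : E) (z : ℂ), strip e z ∈ ι.carrier ↔ z.im = 0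

namespace Collar

variable {ι : GraphEmbedding G X}

/-- The face on the left-hand side of an edge. -/
def leftFace (β : ι.Collar) (e : E) : ι.Face :=
  ι.faceOf (β.strip e Complex.I) fun h => by
    have := (β.strip_mem_carrier e _).1 h
    simp at this

/-- The face on the right-hand side of an edge. -/
def rightFace (β : ι.Collar) (e : E) : ι.Face :=
  ι.faceOf (β.strip e (-Complex.I)) fun h => by
    have := (β.strip_mem_carrier e _).1 h
    simp at this

/-- The dual graph of the embedding. Its vertices are the faces, its edges are the edges of `G`, and
an edge joins the faces on its two sides. -/
def dualGraph (β : ι.Collar) : Multigraph ι.Face E where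
  src := β.leftFace
  tgt := β.rightFace

end Collar

end GraphEmbedding

/-! ### Face boundaries -/

/-- An orientation of an open subset `W` of a surface `X`: a sign for every parametrised open disc
`φ : ℂ → W` (an open embedding) that is reversed by reflection of the disc and is constant along
isotopies of open embeddings into `W`. (The values of `sign` at other functions are irrelevant.)
On a connected surface there are two orientations if it is orientable and none otherwise. -/
structure SurfaceOrientation {X : Type*} [TopologicalSpace X] (W : Set X) where
  sign : (ℂ → X) → ℤˣ
  sign_conj : ∀ φ : ℂ → X, Topology.IsOpenEmbedding φ → Set.range φ ⊆ W →
    sign (fun z => φ (starRingEnd ℂ z)) = -sign φ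
  sign_isotopy : ∀ Φ : unitInterval × ℂ → X, Continuous Φ →
    (∀ t, Topology.IsOpenEmbedding (fun z => Φ (t, z)) ∧ Set.range (fun z => Φ (t, z)) ⊆ W) →
    sign (fun z => Φ (0, z)) = sign (fun z => Φ (1, z))

/-- The standard orientation preserving parametrisation of the open upper half plane by `ℂ`. -/
noncomputable def upperHalf (z : ℂ) : ℂ := ⟨z.re, Real.exp z.im⟩

/-- The standard orientation preserving parametrisation of the open lower half plane by `ℂ`. -/
noncomputable def lowerHalf (z : ℂ) : ℂ := ⟨z.re, -Real.exp (-z.im)⟩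

/-- A choice of directions for the boundaries of all faces. The boundary walks of the faces are
directed by an orientation of the part of the faces that lies in some open neighbourhood of the
graph. If the neighbourhood is all of `X`, this is an orientation of every face; if it is
a small neighbourhood, every face is cut down to annuli along its boundary walks, and
each boundary walk is directed on its own, so that such a choice also exists for faces that are not
orientable. -/
structure BoundaryDirection {V E : Type*} {G : Multigraph V E} {X : Type*} [TopologicalSpace X]
    {ι : GraphEmbedding G X} (β : ι.Collar) where
  nhd : Set X
  isOpen_nhd : IsOpen nhd
  carrier_subset : ι.carrier ⊆ nhd
  strip_subset : ∀ e, Set.range (β.strip e) ⊆ nhd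
  orientation : SurfaceOrientation (nhd \ ι.carrier)

open Classical in
/-- The boundary of the face `f` as a vector over `R`. Every side of an edge `e` that lies in `f`
contributes `1` or `-1` to the entry at `e`: a positively oriented left-hand side is followed by the
boundary walk in the direction of `e`, and a positively oriented right-hand side against it. Hence,
over a field with two elements, the entry counts modulo two the sides of `e` that lie in `f`. -/
noncomputable def BoundaryDirection.boundary {V E : Type*} {G : Multigraph V E} {X : Type*}
    [TopologicalSpace X] {ι : GraphEmbedding G X} {β : ι.Collar} (δ : BoundaryDirection β)
    (R : Type*) [CommRing R] (f : ι.Face) : E → R := fun e =>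
  (if β.leftFace e = f then
    ((δ.orientation.sign (fun z => β.strip e (upperHalf z)) : ℤ) : R) else 0) -
  (if β.rightFace e = f then
    ((δ.orientation.sign (fun z => β.strip e (lowerHalf z)) : ℤ) : R) else 0)

/-! ### Holes, areas and fencing in

In this section `F` is the set of faces of an embedding of a graph with edge set `E`, and `bd f` is
the boundary of the face `f`. A sum of faces in which all coefficients are plus one is given by
the set of faces that occur in it. -/

section Areas

variable {F E R : Type*} [CommRing R]

/-- The embedding is admissible over `R` if the sum over all face boundaries is zero. -/
def IsAdmissible (bd : F → E → R) : Prop :=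
  ∑ᶠ f, bd f = 0

/-- A cycle is facially generated if, in one of its two directions, it is a sum of face boundaries
in which all coefficients are plus one. -/
def IsFaciallyGenerated {V : Type*} {G : Multigraph V E} (bd : F → E → R) (o : G.DirectedCycle) :
    Prop :=
  ∃ A : Set F, ∑ᶠ f ∈ A, bd f = o.vec R ∨ ∑ᶠ f ∈ A, bd f = -o.vec R

/-- An embedding is `S`-facial if all cycles of `G` that are in `S` are facially generated. -/
def IsFacial {V : Type*} (G : Multigraph V E) (bd : F → E → R) (S : Submodule R (E → R)) : Prop :=
  ∀ o : G.DirectedCycle, o.vec R ∈ S → IsFaciallyGenerated bd o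

/-- A hole is a face whose boundary is not in `S`. -/
def IsHole (bd : F → E → R) (S : Submodule R (E → R)) (f : F) : Prop :=
  bd f ∉ S

/-- An area bounded by `S` is a sum of faces with all coefficients plus one such that the sum of the
boundaries of these faces is in `S`. -/
def IsArea (bd : F → E → R) (S : Submodule R (E → R)) (A : Set F) : Prop :=
  ∑ᶠ f ∈ A, bd f ∈ S

/-- The set of holes fenced in by `A`: the set of all holes contained in `A`. -/
def holesIn (bd : F → E → R) (S : Submodule R (E → R)) (A : Set F) : Set F :=
  {f | f ∈ A ∧ IsHole bd S f}

/-- An area is minimal if it contains a hole and no area fences in a proper nonempty subset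
of the set of holes fenced in by it. -/
def IsMinimalArea (bd : F → E → R) (S : Submodule R (E → R)) (A : Set F) : Prop :=
  IsArea bd S A ∧ (holesIn bd S A).Nonempty ∧
    ¬ ∃ B : Set F, IsArea bd S B ∧ (holesIn bd S B).Nonempty ∧ holesIn bd S B ⊂ holesIn bd S A

/-- `S` is fencing in for the embedding if the sets of holes fenced in by any two minimal areas are
identical or disjoint. -/
def IsFencingIn (bd : F → E → R) (S : Submodule R (E → R)) : Prop :=
  ∀ A B : Set F, IsMinimalArea bd S A → IsMinimalArea bd S B →
    holesIn bd S A = holesIn bd S B ∨ Disjoint (holesIn bd S A) (holesIn bd S B)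

/-- Two holes are related if they are contained in a common minimal area. -/
def Related (bd : F → E → R) (S : Submodule R (E → R)) (f g : F) : Prop :=
  IsHole bd S f ∧ IsHole bd S g ∧ ∃ A : Set F, IsMinimalArea bd S A ∧ f ∈ A ∧ g ∈ A

end Areas

end SurfaceDuality

/-! The embedding enters through the matrix of face boundaries. Each edge contributes to it only
through its two sides, with a sign on each. Admissibility makes the two contributions at an edge
cancel in the sum over all faces. Hence the matrix is the directed incidence matrix of the dual
graph `H` with column `e` scaled by a sign `a e`. Adding up the rows in each class of related holes
gives the incidence matrix of the quotient of `H`, with the same scaling.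

These class sums span `S` (`IsFencingIn.span_classBoundary`). By fencing in, a class of holes is the
set of holes of a minimal area. The other faces of that area have boundaries in `S`, so the class
sum lies in `S`. Conversely, every generating cycle is, up to sign, the boundary of an area, and an
area decomposes into sets of holes of minimal areas and single faces that are not holes.

So the orthogonal complement of `S` is, up to rescaling coordinates by `a`, the cycle space of the
quotient, and the supports agree. Minimal supports in the complement are the circuits of the dual of
the local matroid (`localMatroid_dual_indep_iff`); minimal supports in the cycle space are the edge
sets of cycles (`Multigraph.minimal_cycleSpace_iff`). -/

namespace SurfaceDuality

/-! ### Linear matroids given by their space of dependencies, and their duals -/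

section LinearMatroid

variable {E K : Type*} [Fintype E] [Field K]

open Classical in
/-- The columns of the matrix representing the matroid whose dependencies are the elements of
`W`: the classes of the unit vectors modulo `W`. -/
noncomputable def quotientVector (W : Submodule K (E → K)) (e : E) : (E → K) ⧸ W :=
  W.mkQ (Pi.single e 1)

theorem sum_smul_quotientVector (W : Submodule K (E → K)) (x : E → K) :
    ∑ e, x e • quotientVector W e = W.mkQ x := by
  classical
  simp only [quotientVector, ← map_smul, ← map_sum]
  congr 1
  ext e
  simp [Finset.sum_apply, Pi.single_apply]

theorem linearIndepOn_quotientVector_iff (W : Submodule K (E → K)) (I : Set E) :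
    LinearIndepOn K (quotientVector W) I ↔ ∀ x ∈ W, Function.support x ⊆ I → x = 0 := by
  rw [linearIndepOn_iff]
  have key (l : E →₀ K) :
      Finsupp.linearCombination K (quotientVector W) l = W.mkQ (l : E → K) := by
    rw [← sum_smul_quotientVector, Finsupp.linearCombination_apply,
      Finsupp.sum_fintype _ _ (by simp)]
  constructor
  · intro h x hx hxI
    have := h (Finsupp.equivFunOnFinite.symm x)
      (by rw [Finsupp.mem_supported]; intro e he; exact hxI (by simpa using he))
      (by rw [key]; simpa using hx)
    exact congrArg DFunLike.coe this
  · intro h l hl h0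
    rw [key, Submodule.mkQ_apply, Submodule.Quotient.mk_eq_zero] at h0
    have := h l h0 (by
      intro e he
      exact hl (by simpa using he))
    exact DFunLike.coe_injective (by simpa using this)

/-- The exchange axiom: if no element of `J` could be added to `I`, the span of `J` would lie in
that of `I`, against the dimensions. -/
theorem LinearIndepOn.exists_insert_of_ncard_lt {ι M : Type*} [Finite ι] [AddCommGroup M]
    [Module K M] {v : ι → M} {I J : Set ι} (hI : LinearIndepOn K v I) (hJ : LinearIndepOn K v J)
    (hlt : I.ncard < J.ncard) : ∃ e ∈ J, e ∉ I ∧ LinearIndepOn K v (insert e I) := by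
  by_contra! h
  have hspan : v '' J ⊆ Submodule.span K (v '' I) := by
    rintro _ ⟨e, he, rfl⟩
    by_cases heI : e ∈ I
    · exact Submodule.subset_span ⟨e, heI, rfl⟩
    · by_contra hne
      exact h e he heI ((linearIndepOn_insert heI).2 ⟨hI, hne⟩)
  have hle := Submodule.span_le.2 hspan
  have : Module.Finite K (Submodule.span K (v '' I)) :=
    Module.Finite.span_of_finite K (Set.toFinite _)
  have h1 := Submodule.finrank_mono hle
  have hrank {A : Set ι} (hA : LinearIndepOn K v A) :
      Module.finrank K (Submodule.span K (v '' A)) = A.ncard := by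
    classical
    have := Fintype.ofFinite A
    have h := finrank_span_eq_card hA.linearIndependent
    rwa [← Set.image_eq_range, ← Nat.card_eq_fintype_card, Nat.card_coe_set_eq] at h
  rw [hrank hI, hrank hJ] at h1
  omega

/-- The matroid whose dependent sets are the sets containing the support of a nonzero element of
`W`. -/
noncomputable def localMatroid (W : Submodule K (E → K)) : Matroid E :=
  (IndepMatroid.ofFinite (E := Set.univ) Set.finite_univ (LinearIndepOn K (quotientVector W))
    (linearIndepOn_empty _ _) (fun _ _ h hIJ => h.mono hIJ)
    (fun _ _ hI hJ hlt => LinearIndepOn.exists_insert_of_ncard_lt hI hJ hlt)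
    (fun _ _ => Set.subset_univ _)).matroid

theorem localMatroid_indep_iff (W : Submodule K (E → K)) (I : Set E) :
    (localMatroid W).Indep I ↔ LinearIndepOn K (quotientVector W) I := Iff.rfl

theorem quotientVector_mem_span_of_isBasis {W : Submodule K (E → K)} {B X : Set E}
    (hB : (localMatroid W).IsBasis B X) {e : E} (he : e ∈ X) :
    quotientVector W e ∈ Submodule.span K (quotientVector W '' B) := by
  by_cases heB : e ∈ B
  · exact Submodule.subset_span ⟨e, heB, rfl⟩
  · by_contra hne
    exact heB (hB.mem_of_insert_indep he ((linearIndepOn_insert heB).2 ⟨hB.indep, hne⟩))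

/-- Vectors orthogonal to `W` are the linear functionals on the quotient by `W`. The set `C` is
coindependent when the classes outside `C` span the quotient, that is, when no nonzero functional
vanishes on all of them. -/
theorem localMatroid_dual_indep_iff (W : Submodule K (E → K)) (C : Set E) :
    (localMatroid W)✶.Indep C ↔
      ∀ x : E → K, (∀ w ∈ W, ∑ e, x e * w e = 0) → Function.support x ⊆ C → x = 0 := by
  classical
  rw [← Matroid.coindep_def, Matroid.coindep_iff_exists (hX := Set.subset_univ _)]
  constructor
  · rintro ⟨B, hB, hBC⟩ x hx hxC
    let f : ((E → K) ⧸ W) →ₗ[K] K := W.liftQ (∑ e, x e • LinearMap.proj e) (by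
      intro w hw
      simpa using hx w hw)
    have hf (e : E) : f (quotientVector W e) = x e := by
      simp [f, quotientVector, Pi.single_apply]
    ext e
    have he := quotientVector_mem_span_of_isBasis hB.isBasis_ground (Set.mem_univ e)
    have hle : Submodule.span K (quotientVector W '' B) ≤ LinearMap.ker f := by
      rw [Submodule.span_le]
      rintro _ ⟨b, hb, rfl⟩
      rw [SetLike.mem_coe, LinearMap.mem_ker, hf]
      by_contra hne
      exact (hBC hb).2 (hxC hne)
    simpa [hf] using hle he
  · intro h
    obtain ⟨B, hB⟩ := (localMatroid W).exists_isBasis Cᶜ (Set.subset_univ _)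
    refine ⟨B, ?_, fun b hb => ⟨Set.mem_univ _, hB.subset hb⟩⟩
    by_contra hbase
    obtain ⟨e, heB, hins⟩ : ∃ e, e ∉ B ∧ (localMatroid W).Indep (insert e B) := by
      obtain ⟨B', hB', hBB'⟩ := hB.indep.exists_isBase_superset
      obtain ⟨e, he, heB⟩ := Set.exists_of_ssubset (hBB'.ssubset_of_ne (by rintro rfl; exact hbase hB'))
      exact ⟨e, heB, hB'.indep.subset (Set.insert_subset he hBB')⟩
    -- The class of `e` lies outside the span of `B`, so some functional kills that span but not
    -- this class. Its values on the unit vectors form a nonzero orthogonal vector supported in `C`.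
    obtain ⟨f, hfe, hf⟩ := Submodule.exists_le_ker_of_notMem
      ((linearIndepOn_insert heB).1 hins).2
    have hx := h (fun e => f (quotientVector W e)) (fun w hw => by
        have h0 : f (∑ e, w e • quotientVector W e) = 0 := by
          rw [sum_smul_quotientVector, Submodule.mkQ_apply,
            (Submodule.Quotient.mk_eq_zero W).2 hw, map_zero]
        simpa [mul_comm] using h0)
      (fun c hc => by
        by_contra hcC
        exact hc (hf (quotientVector_mem_span_of_isBasis hB hcC)))
    exact hfe (congrFun hx e)

/-- Closing a family upwards does not change its minimal members. This passes between dependent sets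
and supports. -/
theorem minimal_superset_iff {α : Type*} {P Q : Set α → Prop}
    (h : ∀ D, Q D ↔ ∃ D' ⊆ D, P D') (C : Set α) : Minimal Q C ↔ Minimal P C := by
  constructor
  · intro hC
    obtain ⟨D, hDC, hD⟩ := (h C).1 hC.prop
    obtain rfl : D = C := hDC.antisymm (hC.le_of_le ((h D).2 ⟨D, subset_rfl, hD⟩) hDC)
    exact ⟨hD, fun D' hD' hle => hC.le_of_le ((h D').2 ⟨D', subset_rfl, hD'⟩) hle⟩
  · intro hC
    refine ⟨(h C).2 ⟨C, subset_rfl, hC.prop⟩, fun D hD hDC => ?_⟩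
    obtain ⟨D', hD'D, hD'⟩ := (h D).1 hD
    exact (hC.le_of_le hD' (hD'D.trans hDC)).trans hD'D

theorem isLocalMatroid_localMatroid (W : Submodule K (E → K)) :
    IsLocalMatroid W (localMatroid W) := by
  refine ⟨rfl, fun C => ?_⟩
  rw [Matroid.isCircuit_def]
  refine minimal_superset_iff (fun D => ?_) C
  rw [← Matroid.not_indep_iff (hX := Set.subset_univ _), localMatroid_indep_iff,
    linearIndepOn_quotientVector_iff]
  push Not
  constructor
  · rintro ⟨x, hx, hxD, hx0⟩
    exact ⟨_, hxD, Function.support_nonempty_iff.2 hx0, x, hx, rfl⟩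
  · rintro ⟨_, hxD, hne, x, hx, rfl⟩
    exact ⟨x, hx, hxD, Function.support_nonempty_iff.1 hne⟩

end LinearMatroid

/-! ### Cycles and the cycle space of a multigraph -/

namespace Multigraph

variable {V E K : Type*} [Field K] {G : Multigraph V E}

namespace DirectedCycle

theorem vec_edge (o : G.DirectedCycle) (i : Fin (o.n + 1)) :
    o.vec K (o.edge i) = ((o.sign i : ℤ) : K) := by
  classical
  rw [vec, Finset.sum_apply, Finset.sum_eq_single i]
  · simp
  · intro j _ hj
    rw [Pi.single_eq_of_ne]
    exact fun h => hj (o.edge_injective h.symm)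
  · simp

theorem support_vec (o : G.DirectedCycle) : Function.support (o.vec K) = o.edgeSet := by
  classical
  ext e
  constructor
  · intro he
    by_contra hne
    refine he ?_
    rw [vec, Finset.sum_apply]
    refine Finset.sum_eq_zero fun i _ => ?_
    rw [Pi.single_eq_of_ne]
    rintro rfl
    exact hne ⟨i, rfl⟩
  · rintro ⟨i, rfl⟩
    rw [Function.mem_support, vec_edge]
    rcases Int.units_eq_one_or (o.sign i) with h | h <;> simp [h]

end DirectedCycle

variable [Fintype E]

open Classical in
theorem mem_cycleSpace_iff {x : E → K} :
    x ∈ G.cycleSpace K ↔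
      ∀ v, ∑ e, x e * ((if G.tgt e = v then 1 else 0) - if G.src e = v then 1 else 0) = 0 := by
  have h : x ∈ G.cycleSpace K ↔ ∀ v,
      (∑ e, if G.tgt e = v then x e else 0) = ∑ e, if G.src e = v then x e else 0 := by
    simp only [cycleSpace, ← SetLike.mem_coe]
    exact Iff.rfl
  rw [h]
  refine forall_congr' fun v => ?_
  rw [← sub_eq_zero, ← Finset.sum_sub_distrib]
  simp only [mul_sub, mul_ite, mul_one, mul_zero]

namespace DirectedCycle

open Classical in
theorem sum_incidence (o : G.DirectedCycle) {x : E → K} (hx : Function.support x ⊆ o.edgeSet)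
    (v : V) :
    ∑ e, x e * ((if G.tgt e = v then 1 else 0) - if G.src e = v then 1 else 0) =
      ∑ i, ((o.sign i : ℤ) : K) * x (o.edge i) *
        ((if o.vertex (i + 1) = v then 1 else 0) - if o.vertex i = v then 1 else 0) := by
  symm
  refine Fintype.sum_of_injective o.edge o.edge_injective _ _ (fun e he => ?_) (fun i => ?_)
  · have : x e = 0 := by
      by_contra h
      exact he (hx h)
    simp [this]
  · rcases o.joins i with ⟨h, h1, h2⟩ | ⟨h, h1, h2⟩ <;> rw [h, h1, h2] <;> push_cast <;> ring

theorem vec_mem_cycleSpace (o : G.DirectedCycle) : o.vec K ∈ G.cycleSpace K := by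
  classical
  rw [mem_cycleSpace_iff]
  intro v
  rw [o.sum_incidence o.support_vec.subset]
  have h (i) : ((o.sign i : ℤ) : K) * o.vec K (o.edge i) = 1 := by
    rw [vec_edge]
    rcases Int.units_eq_one_or (o.sign i) with h | h <;> simp [h]
  simp only [h, one_mul, Finset.sum_sub_distrib]
  rw [sub_eq_zero]
  -- Each vertex of the cycle is entered as often as it is left: the two sums differ by a cyclic
  -- shift.
  exact Equiv.sum_comp (Equiv.addRight (1 : Fin (o.n + 1)))
    (fun i => if o.vertex i = v then (1 : K) else 0)

/-- Conservation at the vertices makes the signed entry constant around the cycle, so the entries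
vanish all together or not at all. -/
theorem support_eq_edgeSet (o : G.DirectedCycle) {x : E → K} (hx : x ∈ G.cycleSpace K)
    (hsub : Function.support x ⊆ o.edgeSet) (hx0 : x ≠ 0) : Function.support x = o.edgeSet := by
  classical
  rw [mem_cycleSpace_iff] at hx
  set c : Fin (o.n + 1) → K := fun i => ((o.sign i : ℤ) : K) * x (o.edge i) with hc
  have hstep (i) : c (i + 1) = c i := by
    have h := hx (o.vertex (i + 1))
    rw [o.sum_incidence hsub] at h
    simp only [mul_sub, mul_ite, mul_one, mul_zero, Finset.sum_sub_distrib,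
      o.vertex_injective.eq_iff, add_left_inj, Finset.sum_ite_eq', Finset.mem_univ, if_true] at h
    exact (sub_eq_zero.1 h).symm
  have hconst (i) : c i = c 0 := by
    induction i using Fin.induction with
    | zero => rfl
    | succ i ih => rw [← Fin.coeSucc_eq_succ, hstep, ih]
  have hzero (i) : c i = 0 ↔ x (o.edge i) = 0 := by
    rcases Int.units_eq_one_or (o.sign i) with h | h <;> simp [hc, h]
  refine hsub.antisymm ?_
  rintro _ ⟨i, rfl⟩ h
  apply hx0
  ext e
  by_contra hne
  obtain ⟨j, rfl⟩ := hsub hne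
  rw [Pi.zero_apply, ← hzero, hconst, ← hconst i, hzero] at hne
  exact hne h

end DirectedCycle

/-- The initial vertex of an edge traversed along (`true`) or against (`false`) its reference
direction. -/
def tail (G : Multigraph V E) (d : E × Bool) : V := if d.2 then G.src d.1 else G.tgt d.1

/-- The final vertex of an edge traversed along (`true`) or against (`false`) its reference
direction. -/
def head (G : Multigraph V E) (d : E × Bool) : V := if d.2 then G.tgt d.1 else G.src d.1

/-- An infinite walk in a finite graph that never traverses an edge twice in succession contains
a cycle. -/
theorem exists_directedCycle_of_walk (d : ℕ → E × Bool)
    (hd : ∀ i, G.head (d i) = G.tail (d (i + 1))) (hne : ∀ i, (d i).1 ≠ (d (i + 1)).1) :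
    ∃ o : G.DirectedCycle, ∀ e ∈ o.edgeSet, ∃ i, e = (d i).1 := by
  classical
  have hex : ∃ j i, i < j ∧ G.tail (d i) = G.tail (d j) := by
    obtain ⟨a, b, hab, h⟩ := Finite.exists_ne_map_eq_of_infinite d
    rcases hab.lt_or_gt with hlt | hlt
    · exact ⟨b, a, hlt, by rw [h]⟩
    · exact ⟨a, b, hlt, by rw [h]⟩
  -- The first return to an earlier vertex closes the cycle, running from `i` to `j`.
  obtain ⟨j, ⟨i, hij, hrep⟩, hmin⟩ : ∃ j, (∃ i, i < j ∧ G.tail (d i) = G.tail (d j)) ∧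
      ∀ m < j, ¬ ∃ i, i < m ∧ G.tail (d i) = G.tail (d m) :=
    ⟨Nat.find hex, Nat.find_spec hex, fun m hm => Nat.find_min hex hm⟩
  have htail {a b : ℕ} (ha : a < j) (hb : b < j) (h : G.tail (d a) = G.tail (d b)) : a = b := by
    rcases lt_trichotomy a b with hlt | rfl | hlt
    · exact (hmin b hb ⟨a, hlt, h⟩).elim
    · rfl
    · exact (hmin a ha ⟨b, hlt, h.symm⟩).elim
  -- An edge repeated in the same direction repeats its tail too early. In the opposite direction,
  -- step `a + 1` starts where step `b` does, so `b = a + 1`, which `hne` excludes.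
  have hedge {a b : ℕ} (hab : a < b) (hb : b < j) : (d a).1 ≠ (d b).1 := by
    intro h
    by_cases h2 : (d a).2 = (d b).2
    · exact hab.ne (htail (hab.trans hb) hb (by rw [Prod.ext h h2]))
    · have hht : G.head (d a) = G.tail (d b) := by
        unfold head tail
        rw [h]
        revert h2
        cases (d a).2 <;> cases (d b).2 <;> simp
      rw [hd] at hht
      obtain rfl := htail (by omega) hb hht
      exact hne a h
  obtain ⟨n, rfl⟩ : ∃ n, j = i + n + 1 := ⟨j - i - 1, by omega⟩
  refine ⟨{
    n := n
    vertex := fun k => G.tail (d (i + k))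
    edge := fun k => (d (i + k)).1
    sign := fun k => if (d (i + k)).2 then 1 else -1
    vertex_injective := fun a b h => Fin.ext (by
      have := htail (by omega) (by omega) h
      omega)
    edge_injective := fun a b h => Fin.ext (by
      rcases lt_trichotomy (a : ℕ) b with hlt | heq | hlt
      · exact (hedge (by omega) (by omega) h).elim
      · exact heq
      · exact (hedge (by omega) (by omega) h.symm).elim)
    joins := fun k => ?_ }, ?_⟩
  · have hnext : G.tail (d (i + ((k + 1 : Fin (n + 1)) : ℕ))) = G.head (d (i + k)) := by
      rw [hd]
      rcases Fin.eq_castSucc_or_eq_last k with ⟨m, rfl⟩ | rfl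
      · rw [Fin.coeSucc_eq_succ, Fin.val_succ, Fin.val_castSucc, add_assoc]
      · rw [Fin.last_add_one, Fin.val_zero, add_zero, hrep, Fin.val_last]
    rw [hnext]
    unfold head tail
    cases h : (d (i + k)).2 <;> simp
  · rintro _ ⟨k, rfl⟩
    exact ⟨_, rfl⟩

/-- A walk inside the support can always be continued along a different edge, because conservation
forbids a single nonzero term at a vertex. -/
theorem exists_edgeSet_subset_support {x : E → K} (hx : x ∈ G.cycleSpace K) (hx0 : x ≠ 0) :
    ∃ o : G.DirectedCycle, o.edgeSet ⊆ Function.support x := by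
  classical
  -- A loop has zero net incidence, so conservation gives no continuation there; it is already a
  -- cycle.
  by_cases hloop : ∃ e, x e ≠ 0 ∧ G.src e = G.tgt e
  · obtain ⟨e, he, hl⟩ := hloop
    refine ⟨{
      n := 0
      vertex := fun _ => G.src e
      edge := fun _ => e
      sign := fun _ => 1
      vertex_injective := fun a b _ => Subsingleton.elim (α := Fin 1) a b
      edge_injective := fun a b _ => Subsingleton.elim (α := Fin 1) a b
      joins := fun _ => Or.inl ⟨rfl, rfl, hl.symm⟩ }, ?_⟩
    rintro _ ⟨_, rfl⟩
    exact he
  push Not at hloop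
  rw [mem_cycleSpace_iff] at hx
  have hnext (d : {d : E × Bool // x d.1 ≠ 0}) : ∃ d' : {d : E × Bool // x d.1 ≠ 0},
      G.head d.1 = G.tail d'.1 ∧ d.1.1 ≠ d'.1.1 := by
    obtain ⟨⟨e, b⟩, he⟩ := d
    have hterm : x e * ((if G.tgt e = G.head (e, b) then 1 else 0) -
        if G.src e = G.head (e, b) then 1 else 0) ≠ 0 := by
      have hl := hloop e he
      cases b <;> simp_all [head, hl.symm]
    obtain ⟨e', hee', he'⟩ : ∃ e', e' ≠ e ∧ x e' * ((if G.tgt e' = G.head (e, b) then 1 else 0) -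
        if G.src e' = G.head (e, b) then 1 else 0) ≠ 0 := by
      by_contra! h
      refine hterm ?_
      have hsum := hx (G.head (e, b))
      rwa [Finset.sum_eq_single e (fun e' _ h' => h e' h') (by simp)] at hsum
    have hxe' : x e' ≠ 0 := left_ne_zero_of_mul he'
    by_cases hs : G.src e' = G.head (e, b)
    · exact ⟨⟨(e', true), hxe'⟩, by simp [tail, hs], hee'.symm⟩
    · by_cases ht : G.tgt e' = G.head (e, b)
      · exact ⟨⟨(e', false), hxe'⟩, by simp [tail, ht], hee'.symm⟩
      · simp [hs, ht] at he'
  choose next hnext₁ hnext₂ using hnext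
  obtain ⟨e, he⟩ := Function.ne_iff.1 hx0
  let d : ℕ → {d : E × Bool // x d.1 ≠ 0} := fun i => next^[i] ⟨(e, true), he⟩
  have hsucc (i : ℕ) : d (i + 1) = next (d i) := Function.iterate_succ_apply' _ _ _
  obtain ⟨o, ho⟩ := exists_directedCycle_of_walk (G := G) (fun i => (d i).1)
    (fun i => by rw [hsucc]; exact hnext₁ _) (fun i => by rw [hsucc]; exact hnext₂ _)
  refine ⟨o, fun e he => ?_⟩
  obtain ⟨i, rfl⟩ := ho e he
  exact (d i).2

/-- The edge sets of the cycles are the minimal sets among those containing the support of a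
nonzero element of the cycle space. -/
theorem minimal_cycleSpace_iff (C : Set E) :
    Minimal (fun D => ∃ x ∈ G.cycleSpace K, Function.support x ⊆ D ∧ x ≠ 0) C ↔
      ∃ o : G.DirectedCycle, o.edgeSet = C := by
  have hvec (o : G.DirectedCycle) :
      ∃ x ∈ G.cycleSpace K, Function.support x ⊆ o.edgeSet ∧ x ≠ 0 := by
    refine ⟨_, o.vec_mem_cycleSpace, o.support_vec.subset, ?_⟩
    rw [← Function.support_nonempty_iff, o.support_vec]
    exact Set.range_nonempty _
  constructor
  · intro hC
    obtain ⟨x, hx, hxC, hx0⟩ := hC.prop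
    obtain ⟨o, ho⟩ := exists_edgeSet_subset_support hx hx0
    exact ⟨o, (ho.trans hxC).antisymm (hC.le_of_le (hvec o) (ho.trans hxC))⟩
  · rintro ⟨o, rfl⟩
    refine ⟨hvec o, ?_⟩
    rintro D ⟨x, hx, hxD, hx0⟩ hD
    rw [← o.support_eq_edgeSet hx (hxD.trans hD) hx0]
    exact hxD

end Multigraph

/-! ### Minimal areas, classes of related holes, and generation of `S` -/

section Areas

variable {F E K : Type*} [CommRing K] {bd : F → E → K} {S : Submodule K (E → K)} {A B : Set F}

theorem finite_holesIn (hfin : (Function.support bd).Finite) (A : Set F) :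
    (holesIn bd S A).Finite :=
  hfin.subset fun f hf h0 => hf.2 (by rw [h0]; exact S.zero_mem)

theorem isArea_of_forall_not_isHole (h : ∀ f ∈ A, ¬ IsHole bd S f) : IsArea bd S A :=
  finsum_mem_induction (· ∈ S) S.zero_mem (fun _ _ => S.add_mem) fun f hf => not_not.1 (h f hf)

theorem finsum_mem_add_sdiff (hfin : (Function.support bd).Finite) (hBA : B ⊆ A) :
    ∑ᶠ f ∈ B, bd f + ∑ᶠ f ∈ A \ B, bd f = ∑ᶠ f ∈ A, bd f := by
  rw [← finsum_mem_inter_add_sdiff' B (hfin.inter_of_right A), Set.inter_eq_right.2 hBA]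

theorem IsArea.sdiff (hfin : (Function.support bd).Finite) (hA : IsArea bd S A)
    (hB : IsArea bd S B) (hBA : B ⊆ A) : IsArea bd S (A \ B) := by
  unfold IsArea at hA
  rw [← finsum_mem_add_sdiff hfin hBA] at hA
  exact (S.add_mem_iff_right hB).1 hA

theorem holesIn_subset (A : Set F) : holesIn bd S A ⊆ A := fun _ hf => hf.1

theorem IsArea.holesIn (hfin : (Function.support bd).Finite) (hA : IsArea bd S A) :
    IsArea bd S (holesIn bd S A) := by
  unfold IsArea at hA
  rw [← finsum_mem_add_sdiff hfin (holesIn_subset A (bd := bd) (S := S))] at hA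
  exact (S.add_mem_iff_left
    (isArea_of_forall_not_isHole fun f hf hhole => hf.2 ⟨hf.1, hhole⟩)).1 hA

theorem IsArea.exists_isMinimalArea (hfin : (Function.support bd).Finite) (hA : IsArea bd S A)
    (hne : (SurfaceDuality.holesIn bd S A).Nonempty) :
    ∃ B, IsMinimalArea bd S B ∧ SurfaceDuality.holesIn bd S B ⊆ SurfaceDuality.holesIn bd S A := by
  induction hn : (SurfaceDuality.holesIn bd S A).ncard using Nat.strong_induction_on
    generalizing A with
  | _ n ih =>
    by_cases h : ∃ B, IsArea bd S B ∧ (SurfaceDuality.holesIn bd S B).Nonempty ∧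
        SurfaceDuality.holesIn bd S B ⊂ SurfaceDuality.holesIn bd S A
    · obtain ⟨B, hB, hBne, hBA⟩ := h
      obtain ⟨C, hC, hCB⟩ := ih _ (hn ▸ Set.ncard_lt_ncard hBA (finite_holesIn hfin A)) hB hBne rfl
      exact ⟨C, hC, hCB.trans hBA.subset⟩
    · exact ⟨A, ⟨hA, hne, h⟩, subset_rfl⟩

/-- Every area can be reduced to one without holes by removing the sets of holes of minimal areas,
one after the other. -/
theorem IsArea.induction {P : Set F → Prop} (hfin : (Function.support bd).Finite)
    (hA : IsArea bd S A) (base : ∀ A, (∀ f ∈ A, ¬ IsHole bd S f) → P A)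
    (step : ∀ A B, IsMinimalArea bd S B → SurfaceDuality.holesIn bd S B ⊆ A →
      P (A \ SurfaceDuality.holesIn bd S B) → P A) : P A := by
  induction hn : (SurfaceDuality.holesIn bd S A).ncard using Nat.strong_induction_on
    generalizing A with
  | _ n ih =>
    rcases (SurfaceDuality.holesIn bd S A).eq_empty_or_nonempty with h | hne
    · exact base A fun f hf hhole => 
        Set.eq_empty_iff_forall_notMem.1 h f ⟨hf, hhole⟩
    -- Removing only the holes of `B`, rather than all of `B`, still leaves an area, since those
    -- holes form an area by themselves.
    · obtain ⟨B, hB, hBA⟩ := hA.exists_isMinimalArea hfin hne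
      refine step A B hB (hBA.trans (holesIn_subset A))
        (ih _ ?_ (hA.sdiff hfin (hB.1.holesIn hfin) (hBA.trans (holesIn_subset A))) rfl)
      rw [← hn]
      refine Set.ncard_lt_ncard ?_ (finite_holesIn hfin A)
      obtain ⟨f, hf⟩ := hB.2.1
      exact ⟨fun g hg => ⟨hg.1.1, hg.2⟩, fun h => (h (hBA hf)).1.2 hf⟩

theorem IsArea.exists_isMinimalArea_mem (hfin : (Function.support bd).Finite)
    (hA : IsArea bd S A) {f : F} (hfA : f ∈ A) (hf : IsHole bd S f) :
    ∃ B, IsMinimalArea bd S B ∧ f ∈ B := by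
  refine hA.induction (P := fun A => f ∈ A → ∃ B, IsMinimalArea bd S B ∧ f ∈ B) hfin
    (fun A h hfA => (h f hfA hf).elim) (fun A B hB hBA h hfA => ?_) hfA
  by_cases hfB : f ∈ B
  · exact ⟨B, hB, hfB⟩
  · exact h ⟨hfA, fun h => hfB h.1⟩

theorem related_symm {f g : F} (h : Related bd S f g) : Related bd S g f :=
  let ⟨hf, hg, A, hA, hfA, hgA⟩ := h
  ⟨hg, hf, A, hA, hgA, hfA⟩

theorem IsFencingIn.holesIn_eq (hfence : IsFencingIn bd S) (hA : IsMinimalArea bd S A)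
    (hB : IsMinimalArea bd S B) {f : F} (hf : IsHole bd S f) (hfA : f ∈ A) (hfB : f ∈ B) :
    holesIn bd S A = holesIn bd S B :=
  (hfence A B hA hB).resolve_right fun h => Set.disjoint_left.1 h ⟨hfA, hf⟩ ⟨hfB, hf⟩

theorem IsFencingIn.related_trans (hfence : IsFencingIn bd S) {f g h : F}
    (hfg : Related bd S f g) (hgh : Related bd S g h) : Related bd S f h := by
  obtain ⟨hf, hg, A, hA, hfA, hgA⟩ := hfg
  obtain ⟨-, hh, B, hB, hgB, hhB⟩ := hgh
  have hfB : f ∈ holesIn bd S B := hfence.holesIn_eq hA hB hg hgA hgB ▸ ⟨hfA, hf⟩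
  exact ⟨hf, hh, B, hB, hfB.1, hhB⟩

/-- Admissibility makes the set of all faces an area, so every hole is reached when minimal areas
are peeled off it. -/
theorem IsAdmissible.related_refl (hadm : IsAdmissible bd) (hfin : (Function.support bd).Finite)
    {f : F} (hf : IsHole bd S f) : Related bd S f f := by
  have huniv : IsArea bd S Set.univ := by
    rw [IsArea, finsum_mem_univ, hadm]
    exact S.zero_mem
  obtain ⟨B, hB, hfB⟩ := huniv.exists_isMinimalArea_mem hfin (Set.mem_univ f) hf
  exact ⟨hf, hf, B, hB, hfB, hfB⟩

/-- The relation is already symmetric and transitive, so the equivalence it generates adds only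
equality. Faces that are not holes therefore form singleton classes. -/
theorem IsFencingIn.quot_mk_eq_iff (hfence : IsFencingIn bd S) {f g : F} :
    Quot.mk (Related bd S) f = Quot.mk (Related bd S) g ↔ f = g ∨ Related bd S f g := by
  refine ⟨fun h => ?_, ?_⟩
  · have hgen := Quot.eqvGen_exact h
    clear h
    induction hgen with
    | rel _ _ h => exact Or.inr h
    | refl => exact Or.inl rfl
    | symm _ _ _ ih => exact ih.imp Eq.symm related_symm
    | trans _ _ _ _ _ ih₁ ih₂ =>
      rcases ih₁ with rfl | h₁
      · exact ih₂
      · rcases ih₂ with rfl | h₂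
        · exact Or.inr h₁
        · exact Or.inr (hfence.related_trans h₁ h₂)
  · rintro (rfl | h)
    · rfl
    · exact Quot.sound h

theorem IsFencingIn.fiber_eq_singleton (hfence : IsFencingIn bd S) {f : F}
    (hf : ¬ IsHole bd S f) :
    {g | Quot.mk (Related bd S) g = Quot.mk (Related bd S) f} = {f} := by
  ext g
  rw [Set.mem_ofPred_eq, hfence.quot_mk_eq_iff, Set.mem_singleton_iff]
  exact ⟨fun h => h.resolve_right fun h => hf h.2.1, Or.inl⟩

theorem IsFencingIn.fiber_eq_holesIn (hfence : IsFencingIn bd S) (hA : IsMinimalArea bd S A)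
    {f : F} (hf : f ∈ holesIn bd S A) :
    {g | Quot.mk (Related bd S) g = Quot.mk (Related bd S) f} = holesIn bd S A := by
  ext g
  rw [Set.mem_ofPred_eq, hfence.quot_mk_eq_iff]
  constructor
  · rintro (rfl | ⟨hg, _, B, hB, hgB, hfB⟩)
    · exact hf
    · rw [hfence.holesIn_eq hA hB hf.2 hf.1 hfB]
      exact ⟨hgB, hg⟩
  · exact fun hg => Or.inr ⟨hg.2, hf.2, A, hA, hg.1, hf.1⟩

/-- The sum of the boundaries of the faces in a class of related holes, or the boundary of a face
that is not a hole. -/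
noncomputable def classBoundary (bd : F → E → K) (S : Submodule K (E → K))
    (q : Quot (Related bd S)) : E → K :=
  ∑ᶠ f ∈ {f | Quot.mk (Related bd S) f = q}, bd f

theorem IsFencingIn.classBoundary_mem (hfence : IsFencingIn bd S) (hadm : IsAdmissible bd)
    (hfin : (Function.support bd).Finite) (q : Quot (Related bd S)) :
    classBoundary bd S q ∈ S := by
  induction q using Quot.ind with
  | _ f =>
    by_cases hf : IsHole bd S f
    · obtain ⟨-, -, A, hA, hfA, -⟩ := hadm.related_refl hfin hf
      rw [classBoundary, hfence.fiber_eq_holesIn hA ⟨hfA, hf⟩]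
      exact hA.1.holesIn hfin
    · rw [classBoundary, hfence.fiber_eq_singleton hf, finsum_mem_singleton]
      exact not_not.1 hf

/-- Each set of holes peeled off is a full class by fencing in, and each remaining face is a class
of its own. -/
theorem IsFencingIn.finsum_mem_span_classBoundary (hfence : IsFencingIn bd S)
    (hfin : (Function.support bd).Finite) (hA : IsArea bd S A) :
    ∑ᶠ f ∈ A, bd f ∈ Submodule.span K (Set.range (classBoundary bd S)) := by
  refine hA.induction
    (P := fun A => ∑ᶠ f ∈ A, bd f ∈ Submodule.span K (Set.range (classBoundary bd S)))
    hfin (fun A h => ?_) (fun A B hB hBA h => ?_)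
  · refine finsum_mem_induction (· ∈ Submodule.span K (Set.range (classBoundary bd S)))
      (zero_mem _) (fun _ _ => add_mem) fun f hf => Submodule.subset_span ⟨Quot.mk _ f, ?_⟩
    rw [classBoundary, hfence.fiber_eq_singleton (h f hf), finsum_mem_singleton]
  · rw [← finsum_mem_add_sdiff hfin hBA]
    refine add_mem (Submodule.subset_span ?_) h
    obtain ⟨f, hf⟩ := hB.2.1
    exact ⟨Quot.mk _ f, by rw [classBoundary, hfence.fiber_eq_holesIn hB hf]⟩

theorem IsFencingIn.span_classBoundary {V : Type*} {G : Multigraph V E}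
    (hfence : IsFencingIn bd S) (hadm : IsAdmissible bd) (hfin : (Function.support bd).Finite)
    (hgen : G.HasCyclicGeneratingSet S) (hfacial : IsFacial G bd S) :
    Submodule.span K (Set.range (classBoundary bd S)) = S := by
  apply le_antisymm
  · rw [Submodule.span_le]
    rintro _ ⟨q, rfl⟩
    exact hfence.classBoundary_mem hadm hfin q
  · obtain ⟨T, hT⟩ := hgen
    have hle : Submodule.span K ((fun o : G.DirectedCycle => o.vec K) '' T) ≤
        Submodule.span K (Set.range (classBoundary bd S)) := by
      rw [Submodule.span_le]
      rintro _ ⟨o, ho, rfl⟩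
      have hoS : o.vec K ∈ S := hT ▸ Submodule.subset_span ⟨o, ho, rfl⟩
      obtain ⟨A, hA | hA⟩ := hfacial o hoS
      · have := hfence.finsum_mem_span_classBoundary hfin
          (show IsArea bd S A by rw [IsArea, hA]; exact hoS)
        rwa [hA] at this
      -- The reversed cycle serves equally well, as both `S` and the span are closed under negation.
      · have := hfence.finsum_mem_span_classBoundary hfin
          (show IsArea bd S A by rw [IsArea, hA]; exact neg_mem hoS)
        rwa [hA, neg_mem_iff] at this
    exact hT.symm.le.trans hle

open Classical in
theorem finsum_mem_ite_sub_ite (A : Set F) (l r : F) (a b : K) :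
    ∑ᶠ f ∈ A, ((if l = f then a else 0) - if r = f then b else 0) =
      (if l ∈ A then a else 0) - if r ∈ A then b else 0 := by
  have hs (l : F) (a : K) :
      (Function.support fun f => if l = f then (if l ∈ A then a else 0) else 0).Finite :=
    (Set.finite_singleton l).subset fun f hf => by
      by_contra h
      exact hf (if_neg fun h' => h h'.symm)
  have hv (l : F) (a : K) : ∑ᶠ f, (if l = f then (if l ∈ A then a else 0) else 0) =
      if l ∈ A then a else 0 := by
    rw [finsum_eq_single _ l fun f hf => if_neg hf.symm, if_pos rfl]
  rw [finsum_mem_def, ← hv l a, ← hv r b, ← finsum_sub_distrib (hs l a) (hs r b)]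
  refine finsum_congr fun f => ?_
  by_cases hf : f ∈ A
  · rw [Set.indicator_of_mem hf]
    congr 1 <;> split_ifs with h1 h2 <;> first | rfl | (subst h1; contradiction)
  · rw [Set.indicator_of_notMem hf]
    split_ifs <;> simp_all

theorem finsum_mem_apply (hfin : (Function.support bd).Finite) (A : Set F) (e : E) :
    (∑ᶠ f ∈ A, bd f) e = ∑ᶠ f ∈ A, bd f e :=
  AddMonoidHom.map_finsum_mem' (Pi.evalAddMonoidHom (fun _ : E => K) e) (hfin.inter_of_right A)

end Areas

/-! ### Orthogonality to `S` and the quotient of the dual graph -/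

theorem forall_mem_span_sum_mul_eq_zero_iff {E K ι : Type*} [Fintype E] [Field K]
    (w : ι → E → K) (x : E → K) :
    (∀ y ∈ Submodule.span K (Set.range w), ∑ e, x e * y e = 0) ↔
      ∀ i, ∑ e, x e * w i e = 0 := by
  refine ⟨fun h i => h _ (Submodule.subset_span ⟨i, rfl⟩), fun h y hy => ?_⟩
  induction hy using Submodule.span_induction with
  | mem _ hy => obtain ⟨i, rfl⟩ := hy; exact h i
  | zero => simp
  | add _ _ _ _ h₁ h₂ => simp [mul_add, Finset.sum_add_distrib, h₁, h₂]
  | smul c _ _ h => simp [mul_left_comm _ c, ← Finset.mul_sum, h]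

section Duality

variable {F V E K : Type*} [Fintype E] [Field K] {bd : F → E → K}
  {S : Submodule K (E → K)} {H : Multigraph F E} {a b : E → K}

open Classical in
-- Only faces at a side of one of the finitely many edges have nonzero boundary. This matters
-- because `finsum` takes the value zero on infinite support.
theorem finite_support_of_incidence
    (hbd : ∀ f e, bd f e = (if H.src e = f then a e else 0) - if H.tgt e = f then b e else 0) :
    (Function.support bd).Finite := by
  refine ((Set.finite_range H.src).union (Set.finite_range H.tgt)).subset fun f hf => ?_
  by_contra h
  refine hf (funext fun e => ?_)
  rw [hbd, if_neg fun h' => h (Or.inl ⟨e, h'⟩), if_neg fun h' => h (Or.inr ⟨e, h'⟩), sub_zero,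
    Pi.zero_apply]

open Classical in
-- The sum of all face boundaries has entry `a e - b e` at `e`.
theorem IsAdmissible.coeff_eq (hadm : IsAdmissible bd)
    (hbd : ∀ f e, bd f e = (if H.src e = f then a e else 0) - if H.tgt e = f then b e else 0) :
    a = b := by
  ext e
  have h := finsum_mem_apply (finite_support_of_incidence hbd) Set.univ e
  rw [finsum_mem_univ, hadm, finsum_mem_congr rfl fun f _ => hbd f e, finsum_mem_ite_sub_ite] at h
  simpa [sub_eq_zero] using h.symm

open Classical in
/-- If the face boundaries form, up to signs, the incidence matrix of `H`, then the cycle matroid of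
`H` with related holes identified is dual to the local matroid. -/
theorem isCycleMatroid_dual_localMatroid {G : Multigraph V E}
    (hbd : ∀ f e, bd f e = (if H.src e = f then a e else 0) - if H.tgt e = f then b e else 0)
    (ha : ∀ e, a e ≠ 0) (hgen : G.HasCyclicGeneratingSet S) (hfacial : IsFacial G bd S)
    (hadm : IsAdmissible bd) (hfence : IsFencingIn bd S) :
    (H.identify (Related bd S)).IsCycleMatroid (localMatroid S)✶ := by
  obtain rfl := hadm.coeff_eq hbd
  have hfin := finite_support_of_incidence hbd
  have hclass (q : Quot (Related bd S)) (e : E) : classBoundary bd S q e =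
      a e * ((if (H.identify (Related bd S)).src e = q then 1 else 0) -
        if (H.identify (Related bd S)).tgt e = q then 1 else 0) := by
    rw [classBoundary, finsum_mem_apply hfin]
    simp only [hbd, finsum_mem_ite_sub_ite, mul_sub, mul_ite, mul_one, mul_zero]
    rfl
  have horth (x : E → K) : (∀ w ∈ S, ∑ e, x e * w e = 0) ↔
      (fun e => x e * a e) ∈ (H.identify (Related bd S)).cycleSpace K := by
    conv_lhs => rw [← hfence.span_classBoundary hadm hfin hgen hfacial]
    rw [forall_mem_span_sum_mul_eq_zero_iff, Multigraph.mem_cycleSpace_iff]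
    refine forall_congr' fun q => ?_
    -- Face boundaries count source minus target, while the cycle space counts target minus source.
    rw [← neg_eq_zero, ← Finset.sum_neg_distrib]
    refine Eq.congr_left (Finset.sum_congr rfl fun e _ => ?_)
    rw [hclass]
    ring
  have hsupp (x : E → K) : Function.support (fun e => x e * a e) = Function.support x := by
    ext e
    simp [ha e]
  refine ⟨rfl, fun C => ?_⟩
  rw [Matroid.isCircuit_def, ← Multigraph.minimal_cycleSpace_iff (K := K)]
  have hdep (D : Set E) : (localMatroid S)✶.Dep D ↔
      ∃ x ∈ (H.identify (Related bd S)).cycleSpace K, Function.support x ⊆ D ∧ x ≠ 0 := by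
    rw [← Matroid.not_indep_iff (hX := Set.subset_univ _), localMatroid_dual_indep_iff]
    push Not
    constructor
    · rintro ⟨x, hx, hxD, hx0⟩
      refine ⟨_, (horth x).1 hx, (hsupp x).subset.trans hxD, ?_⟩
      rwa [← Function.support_nonempty_iff, hsupp, Function.support_nonempty_iff]
    · rintro ⟨x, hx, hxD, hx0⟩
      -- Dividing by `a` inverts the rescaling that carries orthogonal vectors to the cycle space.
      have hx' : (fun e => x e / a e * a e) = x := funext fun e => div_mul_cancel₀ _ (ha e)
      have hs := hsupp fun e => x e / a e
      rw [hx'] at hs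
      refine ⟨fun e => x e / a e, (horth _).2 (by rwa [hx']), hs ▸ hxD, ?_⟩
      rwa [← Function.support_nonempty_iff, ← hs, Function.support_nonempty_iff]
  rw [show (localMatroid S)✶.Dep = _ from funext fun D => propext (hdep D)]

end Duality

end SurfaceDuality

theorem mainTheorem6 {V E X : Type*} [Finite V] [Fintype E]
    [TopologicalSpace X] [T2Space X] [CompactSpace X] [ConnectedSpace X]
    [ChartedSpace (EuclideanSpace ℝ (Fin 2)) X]
    (p : ℕ) (hp : p = 2 ∨ p = 3)
    (G : SurfaceDuality.Multigraph V E)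
    (S : Submodule (ZMod p) (E → ZMod p))
    (hS : S ≤ G.cycleSpace (ZMod p))
    (hgen : G.HasCyclicGeneratingSet S)
    (ι : SurfaceDuality.GraphEmbedding G X) (β : ι.Collar)
    (δ : SurfaceDuality.BoundaryDirection β)
    (hfacial : SurfaceDuality.IsFacial G (δ.boundary (ZMod p)) S)
    (hadm : SurfaceDuality.IsAdmissible (δ.boundary (ZMod p)))
    (hfence : SurfaceDuality.IsFencingIn (δ.boundary (ZMod p)) S) :
    Equivalence (fun f g : {f : ι.Face // SurfaceDuality.IsHole (δ.boundary (ZMod p)) S f} =>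
      SurfaceDuality.Related (δ.boundary (ZMod p)) S f g) ∧
    ∃ M : Matroid E, SurfaceDuality.IsLocalMatroid S M ∧
      (β.dualGraph.identify
        (SurfaceDuality.Related (δ.boundary (ZMod p)) S)).IsCycleMatroid M✶ := by
  have : Fact p.Prime := ⟨by rcases hp with rfl | rfl <;> norm_num⟩
  have hbd (f : ι.Face) (e : E) := show δ.boundary (ZMod p) f e = _ from rfl
  have hfin : (Function.support (δ.boundary (ZMod p))).Finite :=
    SurfaceDuality.finite_support_of_incidence (H := β.dualGraph) hbd
  refine ⟨⟨fun f => hadm.related_refl hfin f.2, SurfaceDuality.related_symm,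
    hfence.related_trans⟩, SurfaceDuality.localMatroid S,
    SurfaceDuality.isLocalMatroid_localMatroid S,
    SurfaceDuality.isCycleMatroid_dual_localMatroid hbd (fun e => ?_) hgen hfacial hadm hfence⟩
  -- The column scaling is the sign of the left-hand side of `e`, hence `1` or `-1` and nonzero in
  -- the field.
  rcases Int.units_eq_one_or
    (δ.orientation.sign fun z => β.strip e (SurfaceDuality.upperHalf z)) with h | h <;> simp [h]
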